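/- Consider a discrete-time system $x^{+}=f(x,u)$ with $\dim x=n$, $\dim u=m$, where $f$ is smooth on an open set, $\operatorname{rank}(\partial_u f)=m$ and $\operatorname{rank}(\partial_{(x,u)}f)=n$ there. Let $(x_0,u_0)$ be an equilibrium, $f(x_0,u_0)=x_0$, and let $\zeta=g(x,u)$ be $m$ functions such that $(x,u)\mapsto(f(x,u),g(x,u))$ is a local diffeomorphism around $(x_0,u_0)$, with local inverse $x=\psi_x(x^+,\zeta)$, $u=\psi_u(x^+,\zeta)$. On the space with coordinates $(\ldots,\zeta_{[-2]},\zeta_{[-1]},x,u,u_{[1]},\ldots)$ let $\delta$ be the forward-shift, $\delta h(\ldots,\zeta_{[-1]},x,u,u_{[1]},\ldots)=h(\ldots,\zeta_{[-1]},g(x,u),f(x,u),u_{[1]},u_{[2]},\ldots)$, where $g(x,u)$ takes the place of $\zeta_{[-1]}$ and $f(x,u)$ that of $x$, and let $\delta^{-1}$ be its local inverse, the backward-shift, which replaces $x,u$ by $\psi_x(x,\zeta_{[-1]}),\psi_u(x,\zeta_{[-1]})$, each $\zeta_{[-k]}$ by $\zeta_{[-k-1]}$, $u_{[1]}$ by $u$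 and $u_{[k+1]}$ by $u_{[k]}$ for $k\ge1$. Let $h_{[k]}=\delta^k h$ for $k\in\mathbb Z$; for multi-indices $A,B\in\mathbb Z^m$ let $y_{[A,B]}$ denote the collection of all $y^j_{[k]}$ with $A_j\le k\le B_j$, $j=1,\dots,m$, and let $y_{[A]}=(y^1_{[A_1]},\dots,y^m_{[A_m]})$. Let the system be flat around $(x_0,u_0)$ with a flat output $y^j=\varphi^j(\zeta_{[-Q_1,-1]},x,u,u_{[1,Q_2]})$, $j=1,\dots,m$, and a parameterizing map $x=F_x(y_{[-R_1,R_2-1]})$, $u=F_u(y_{[-R_1,R_2]})$, with multi-indices $Q_1,Q_2,R_1,R_2\in\mathbb N_0^m$. That is, $\varphi,F_x,F_u$ are smooth near the respective equilibrium values, and the two identities hold locally around the equilibrium when $\delta^k\varphi^j$ is inserted for $y^j_{[k]}$. Then, on a neighborhood of the equilibrium value of $y_{[-R_1,R_2]}$, the following holds, where $F_x$ and $F_u$ are regarded as functions of $y_{[-R_1,R_2]}$: 1. If the flat output is a forward-flat output, i.e. only forward-shifts occur both in the flat output and in the parameterization ($Q_1=0$ and $R_1=0$), then the $n\times m$ matrix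 $\partial_{y_{[-R_1]}}F_x=\partial_{y}F_x$ has rank $m$. 2. If the flat output is a backward-flat output, i.e. only backward-shifts occur both in the flat output and in the parameterization ($Q_2=0$ and $R_2=0$), then the $m\times m$ matrix $\partial_{y_{[R_2]}}F_u=\partial_{y}F_u$ has rank $m$. -/

import Mathlib

open Filter Topology
open scoped ContDiff

/-- `h` is smooth on a neighbourhood of the point `p`. -/
def SmoothNear {E F : Type*} [NormedAddCommGroup E] [NormedSpace ℝ E]
    [NormedAddCommGroup F] [NormedSpace ℝ F] (h : E → F) (p : E) : Prop :=
  ∀ᶠ q in 𝓝 p, ContDiffAt ℝ ∞ h q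

/-- A nonlinear time-invariant discrete-time system `x⁺ = f (x, u)` with `n` states and `m` inputs,
given by smooth functions on an open set, with independent inputs (`rank ∂_u f = m`) and satisfying
the submersivity condition (`rank ∂_(x,u) f = n`). -/
structure DTSystem (n m : ℕ) where
  dom : Set ((Fin n → ℝ) × (Fin m → ℝ))
  isOpen_dom : IsOpen dom
  f : (Fin n → ℝ) × (Fin m → ℝ) → (Fin n → ℝ)
  smooth_f : ContDiffOn ℝ ∞ f dom
  rank_u : ∀ p ∈ dom,
    Module.finrank ℝ (LinearMap.range (fderiv ℝ (fun u => f (p.1, u)) p.2).toLinearMap) = m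
  rank_xu : ∀ p ∈ dom, Module.finrank ℝ (LinearMap.range (fderiv ℝ f p).toLinearMap) = n

/-- `(x₀, u₀)` is an equilibrium of the system. -/
def DTSystem.IsEquilibrium {n m : ℕ} (S : DTSystem n m) (x₀ : Fin n → ℝ) (u₀ : Fin m → ℝ) : Prop :=
  (x₀, u₀) ∈ S.dom ∧ S.f (x₀, u₀) = x₀

/-- A choice of `m` functions `ζ = g (x, u)` such that `(x, u) ↦ (x⁺, ζ) = (f (x, u), g (x, u))` is
a diffeomorphism from a neighbourhood of `(x₀, u₀)` onto an open set, with inverse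
`(x⁺, ζ) ↦ (ψ_x (x⁺, ζ), ψ_u (x⁺, ζ))`. -/
structure DTSystem.Extension {n m : ℕ} (S : DTSystem n m) (x₀ : Fin n → ℝ) (u₀ : Fin m → ℝ) where
  e : OpenPartialHomeomorph ((Fin n → ℝ) × (Fin m → ℝ)) ((Fin n → ℝ) × (Fin m → ℝ))
  mem_source : (x₀, u₀) ∈ e.source
  source_subset : e.source ⊆ S.dom
  fst_eq : ∀ p ∈ e.source, (e p).1 = S.f p
  smooth : ContDiffOn ℝ ∞ e e.source
  smooth_symm : ContDiffOn ℝ ∞ e.symm e.target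

/-- The space with coordinates `(…, ζ_[-2], ζ_[-1], x, u, u_[1], …)`, with the product topology:
for `z = (ζ, x, u)`, `ζ i` stands for `ζ_[-(i+1)]` and `u i` for `u_[i]`. -/
abbrev ExtSpace (n m : ℕ) : Type := (ℕ → Fin m → ℝ) × (Fin n → ℝ) × (ℕ → Fin m → ℝ)

/-- The sequence `a, s 0, s 1, …`. -/
def prependSeq {A : Type*} (a : A) (s : ℕ → A) : ℕ → A
  | 0 => a
  | k + 1 => s k

namespace DTSystem.Extension

variable {n m : ℕ} {S : DTSystem n m} {x₀ : Fin n → ℝ} {u₀ : Fin m → ℝ}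

/-- The functions `ζ = g (x, u)`. -/
def g (X : S.Extension x₀ u₀) (p : (Fin n → ℝ) × (Fin m → ℝ)) : Fin m → ℝ := (X.e p).2

/-- The point transformation behind the forward-shift operator `δ`, that is `δ h = h ∘ fwd`:
`(…, ζ_[-1], x, u, u_[1], …) ↦ (…, ζ_[-1], g (x, u), f (x, u), u_[1], u_[2], …)`. -/
def fwd (X : S.Extension x₀ u₀) (z : ExtSpace n m) : ExtSpace n m :=
  (prependSeq (X.g (z.2.1, z.2.2 0)) z.1, S.f (z.2.1, z.2.2 0), fun k => z.2.2 (k + 1))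

/-- The point transformation behind the backward-shift operator `δ⁻¹`, that is `δ⁻¹ h = h ∘ bwd`:
`(…, ζ_[-2], ζ_[-1], x, u, …) ↦ (…, ζ_[-2], ψ_x (x, ζ_[-1]), ψ_u (x, ζ_[-1]), u, …)`. -/
def bwd (X : S.Extension x₀ u₀) (z : ExtSpace n m) : ExtSpace n m :=
  (fun k => z.1 (k + 1), (X.e.symm (z.2.1, z.1 0)).1,
    prependSeq (X.e.symm (z.2.1, z.1 0)).2 z.2.2)

/-- The `k`-fold shift, `k ∈ ℤ`: forward if `k ≥ 0` and backward if `k < 0`. -/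
def shift (X : S.Extension x₀ u₀) : ℤ → ExtSpace n m → ExtSpace n m
  | Int.ofNat k => X.fwd^[k]
  | Int.negSucc k => X.bwd^[k + 1]

/-- The equilibrium `(…, ζ₀, ζ₀, x₀, u₀, u₀, …)` of the extended space, `ζ₀ = g (x₀, u₀)`. -/
def eqPoint (X : S.Extension x₀ u₀) : ExtSpace n m :=
  (fun _ => X.g (x₀, u₀), x₀, fun _ => u₀)

end DTSystem.Extension

/-- The finite-dimensional space with coordinates `(ζ_[-Q₁,-1], x, u_[0,Q₂])`, for multi-indices
`Q₁`, `Q₂`: the coordinate `⟨j, i⟩` of the first factor is the `j`-th component of `ζ_[-(i+1)]`, the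
coordinate `⟨j, i⟩` of the last factor is the `j`-th component of `u_[i]`. -/
abbrev OutputVars (n : ℕ) {m : ℕ} (Q₁ Q₂ : Fin m → ℕ) : Type :=
  (((j : Fin m) × Fin (Q₁ j)) → ℝ) × (Fin n → ℝ) × (((j : Fin m) × Fin (Q₂ j + 1)) → ℝ)

/-- The coordinates `(ζ_[-Q₁,-1], x, u_[0,Q₂])` of a point of the extended space. -/
def outputVars {n m : ℕ} (Q₁ Q₂ : Fin m → ℕ) (z : ExtSpace n m) : OutputVars n Q₁ Q₂ :=
  (fun w => z.1 w.2 w.1, z.2.1, fun w => z.2.2 w.2 w.1)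

/-- The indices `(j, k)`, `a j ≤ k ≤ b j`, of the coordinates `y^j_[k]` that make up `y_[a,b]`. -/
abbrev Window {m : ℕ} (a b : Fin m → ℤ) : Type := (j : Fin m) × Finset.Icc (a j) (b j)

/-- The index set of `y_[-R₁,R₂]`. -/
abbrev WindowU {m : ℕ} (R₁ R₂ : Fin m → ℕ) : Type :=
  Window (fun j => -(R₁ j : ℤ)) (fun j => (R₂ j : ℤ))

/-- The index set of `y_[-R₁,R₂-1]`. -/
abbrev WindowX {m : ℕ} (R₁ R₂ : Fin m → ℕ) : Type :=
  Window (fun j => -(R₁ j : ℤ)) (fun j => (R₂ j : ℤ) - 1)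

/-- The part `y_[-R₁,R₂-1]` of `y_[-R₁,R₂]`. -/
def restrictX {m : ℕ} {R₁ R₂ : Fin m → ℕ} (y : WindowU R₁ R₂ → ℝ) : WindowX R₁ R₂ → ℝ :=
  fun w => y ⟨w.1, w.2.1, by 
    have h := Finset.mem_Icc.1 w.2.2
    exact Finset.mem_Icc.2 ⟨h.1, by have := h.2; dsimp only at this ⊢; omega⟩⟩

/-- The index `(j, -R₁ j)` of `y^j_[-r_(1,j)]`. -/
def bottomIdx {m : ℕ} (R₁ R₂ : Fin m → ℕ) (j : Fin m) : WindowU R₁ R₂ :=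
  ⟨j, -(R₁ j : ℤ), Finset.mem_Icc.2 (by dsimp only; omega)⟩

/-- The index `(j, R₂ j)` of `y^j_[r_(2,j)]`. -/
def topIdx {m : ℕ} (R₁ R₂ : Fin m → ℕ) (j : Fin m) : WindowU R₁ R₂ :=
  ⟨j, (R₂ j : ℤ), Finset.mem_Icc.2 (by dsimp only; omega)⟩

/-- A flat output `y = φ (ζ_[-Q₁,-1], x, u, u_[1,Q₂])` of the system around `(x₀, u₀)` together with
a parameterization `x = F_x (y_[-R₁,R₂-1])`, `u = F_u (y_[-R₁,R₂])` of the system variables. The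
functions are defined locally around the equilibrium, and so the two identities hold on a
neighbourhood of the equilibrium of the extended space, with the `k`-fold shift of `φ` inserted for
`y_[k]`. -/
structure FlatParameterization {n m : ℕ} {S : DTSystem n m} {x₀ : Fin n → ℝ} {u₀ : Fin m → ℝ}
    (X : S.Extension x₀ u₀) where
  Q₁ : Fin m → ℕ
  Q₂ : Fin m → ℕ
  φ : OutputVars n Q₁ Q₂ → (Fin m → ℝ)
  smooth_φ : SmoothNear φ (outputVars Q₁ Q₂ X.eqPoint)
  R₁ : Fin m → ℕ
  R₂ : Fin m → ℕ
  Fx : (WindowX R₁ R₂ → ℝ) → (Fin n → ℝ)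
  Fu : (WindowU R₁ R₂ → ℝ) → (Fin m → ℝ)
  smooth_Fx : SmoothNear Fx (fun w => φ (outputVars Q₁ Q₂ X.eqPoint) w.1)
  smooth_Fu : SmoothNear Fu (fun w => φ (outputVars Q₁ Q₂ X.eqPoint) w.1)
  x_eq : ∀ᶠ z in 𝓝 X.eqPoint,
    z.2.1 = Fx (fun w => φ (outputVars Q₁ Q₂ (X.shift w.2 z)) w.1)
  u_eq : ∀ᶠ z in 𝓝 X.eqPoint,
    z.2.2 0 = Fu (fun w => φ (outputVars Q₁ Q₂ (X.shift w.2 z)) w.1)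

namespace FlatParameterization

variable {n m : ℕ} {S : DTSystem n m} {x₀ : Fin n → ℝ} {u₀ : Fin m → ℝ} {X : S.Extension x₀ u₀}

/-- Only forward-shifts occur: `y = φ (x, u, u_[1,Q₂])`, `x = F_x (y_[0,R₂-1])`,
`u = F_u (y_[0,R₂])`. -/
def IsForwardFlat (P : FlatParameterization X) : Prop := P.Q₁ = 0 ∧ P.R₁ = 0

/-- Only backward-shifts occur: `y = φ (ζ_[-Q₁,-1], x, u)`, `x = F_x (y_[-R₁,-1])`,
`u = F_u (y_[-R₁,0])`. -/
def IsBackwardFlat (P : FlatParameterization X) : Prop := P.Q₂ = 0 ∧ P.R₂ = 0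

/-- The equilibrium values of `y_[-R₁,R₂]`. -/
def yEq (P : FlatParameterization X) : WindowU P.R₁ P.R₂ → ℝ :=
  fun w => P.φ (outputVars P.Q₁ P.Q₂ X.eqPoint) w.1

/-- The `n × m` submatrix `∂_(y_[-R₁]) F_x` of the Jacobian of the parameterizing map, at
`y = y_[-R₁,R₂]`. (`F_x` is regarded as a function of all of `y_[-R₁,R₂]`.) -/
noncomputable def jacFx (P : FlatParameterization X) (y : WindowU P.R₁ P.R₂ → ℝ) :
    Matrix (Fin n) (Fin m) ℝ :=
  Matrix.of fun i j =>
    fderiv ℝ (fun y' => P.Fx (restrictX y')) y (Pi.single (bottomIdx P.R₁ P.R₂ j) 1) i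

/-- The `m × m` submatrix `∂_(y_[R₂]) F_u` of the Jacobian of the parameterizing map, at
`y = y_[-R₁,R₂]`. -/
noncomputable def jacFu (P : FlatParameterization X) (y : WindowU P.R₁ P.R₂ → ℝ) :
    Matrix (Fin m) (Fin m) ℝ :=
  Matrix.of fun i j => fderiv ℝ P.Fu y (Pi.single (topIdx P.R₁ P.R₂ j) 1) i

end FlatParameterization

/-! Full column rank is an open condition, so it suffices to prove it at the equilibrium, where
everything can be linearized. Write E for the derivative of (f, g) there. The linearized system has
the exponential solutions x_[k] = z^k ξ, u_[k] = z^k v, ζ_[k] = z^k η with E(ξ, v) = (z ξ, η), and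
along them y_[k] = z^k y. The differentiated parameterization recovers ξ and v from y, while the
solutions (ξ, v) form a space of dimension at least m; hence every y occurs (`exists_expTraj`). So
for all z ≠ 0 and all y the linearized parameterization satisfies the linearized state equation and
returns y when inserted in the linearized output (`linearized_identities`).

The Jacobian blocks in question appear as limits in z. In the forward case only nonnegative powers
of z occur, and z → 0 isolates ∂_y F_x (`forward_injective`); in the backward case only nonpositive
powers occur, and z → ∞ isolates ∂_y F_u (`backward_injective`). If the block kills y, then x, u and
η (as far as they enter the output) tend to 0, so the output, which is constantly y, tends to 0. -/

/-- The curve `c` in the extended space has, coordinate by coordinate, the velocity `d` at `0`. -/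
def HasCoordDeriv {n m : ℕ} (c : ℝ → ExtSpace n m) (d : ExtSpace n m) : Prop :=
  (∀ k, HasDerivAt (fun t => (c t).1 k) (d.1 k) 0) ∧ HasDerivAt (fun t => (c t).2.1) d.2.1 0 ∧
    ∀ k, HasDerivAt (fun t => (c t).2.2 k) (d.2.2 k) 0

/-- The trajectory with `x_[k] = z ^ k • ξ`, `u_[k] = z ^ k • v` and `ζ_[k] = z ^ k • η`. -/
noncomputable def expTraj {n m : ℕ} (z : ℝ) (ξ : Fin n → ℝ) (v η : Fin m → ℝ) : ExtSpace n m :=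
  (fun k => z⁻¹ ^ (k + 1) • η, ξ, fun k => z ^ k • v)

theorem hasCoordDeriv_line {n m : ℕ} (p d : ExtSpace n m) :
    HasCoordDeriv (fun t : ℝ => p + t • d) d := by
  have key : ∀ {F : Type} [NormedAddCommGroup F] [NormedSpace ℝ F] (a b : F),
      HasDerivAt (fun t : ℝ => a + t • b) b 0 := by
    intro F _ _ a b
    simpa using ((hasDerivAt_id (0 : ℝ)).smul_const b).const_add a
  exact ⟨fun k => key _ _, key _ _, fun k => key _ _⟩

theorem HasCoordDeriv.outputVars {n m : ℕ} (Q₁ Q₂ : Fin m → ℕ) {c : ℝ → ExtSpace n m}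
    {d : ExtSpace n m} (h : HasCoordDeriv c d) :
    HasDerivAt (fun t => outputVars Q₁ Q₂ (c t)) (outputVars Q₁ Q₂ d) 0 := by
  refine HasDerivAt.prodMk ?_ (HasDerivAt.prodMk h.2.1 ?_)
  · exact hasDerivAt_pi.2 fun w => hasDerivAt_pi.1 (h.1 w.2) w.1
  · exact hasDerivAt_pi.2 fun w => hasDerivAt_pi.1 (h.2.2 w.2) w.1

theorem tendsto_line {n m : ℕ} (p d : ExtSpace n m) :
    Tendsto (fun t : ℝ => p + t • d) (𝓝 0) (𝓝 p) := by
  have : Continuous fun t : ℝ => p + t • d := by fun_prop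
  simpa using this.tendsto 0

/-! ### Linearized shifts at the equilibrium -/

namespace DTSystem.Extension

variable {n m : ℕ} {S : DTSystem n m} {x₀ : Fin n → ℝ} {u₀ : Fin m → ℝ}

theorem e_eq (h_eq : S.IsEquilibrium x₀ u₀) (X : S.Extension x₀ u₀) :
    X.e (x₀, u₀) = (x₀, X.g (x₀, u₀)) :=
  Prod.ext ((X.fst_eq _ X.mem_source).trans h_eq.2) rfl

theorem symm_eq (h_eq : S.IsEquilibrium x₀ u₀) (X : S.Extension x₀ u₀) :
    X.e.symm (x₀, X.g (x₀, u₀)) = (x₀, u₀) := by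
  rw [← e_eq h_eq X, X.e.left_inv X.mem_source]

theorem fwd_eqPoint (h_eq : S.IsEquilibrium x₀ u₀) (X : S.Extension x₀ u₀) :
    X.fwd X.eqPoint = X.eqPoint := by
  refine Prod.ext (funext fun k => ?_) (Prod.ext h_eq.2 rfl)
  cases k <;> rfl

theorem bwd_eqPoint (h_eq : S.IsEquilibrium x₀ u₀) (X : S.Extension x₀ u₀) :
    X.bwd X.eqPoint = X.eqPoint := by
  have h := symm_eq h_eq X
  refine Prod.ext rfl (Prod.ext ?_ (funext fun k => ?_))
  · exact congrArg (fun p => p.1) h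
  · cases k
    · exact congrArg (fun p => p.2) h
    · rfl

theorem hasFDerivAt_e (X : S.Extension x₀ u₀) :
    HasFDerivAt X.e (fderiv ℝ X.e (x₀, u₀)) (x₀, u₀) :=
  ((X.smooth.contDiffAt (X.e.open_source.mem_nhds X.mem_source)).differentiableAt
    (by simp)).hasFDerivAt

theorem hasFDerivAt_symm (h_eq : S.IsEquilibrium x₀ u₀) (X : S.Extension x₀ u₀) :
    HasFDerivAt X.e.symm (fderiv ℝ X.e.symm (x₀, X.g (x₀, u₀))) (x₀, X.g (x₀, u₀)) := by
  have hmem : (x₀, X.g (x₀, u₀)) ∈ X.e.target := e_eq h_eq X ▸ X.e.map_source X.mem_source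
  exact ((X.smooth_symm.contDiffAt (X.e.open_target.mem_nhds hmem)).differentiableAt
    (by simp)).hasFDerivAt

theorem fderiv_symm_fderiv (h_eq : S.IsEquilibrium x₀ u₀) (X : S.Extension x₀ u₀)
    (p : (Fin n → ℝ) × (Fin m → ℝ)) :
    fderiv ℝ X.e.symm (x₀, X.g (x₀, u₀)) (fderiv ℝ X.e (x₀, u₀) p) = p := by
  have h1 : HasFDerivAt X.e.symm (fderiv ℝ X.e.symm (x₀, X.g (x₀, u₀))) (X.e (x₀, u₀)) := by
    rw [e_eq h_eq X]; exact hasFDerivAt_symm h_eq X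
  have h2 := h1.comp _ (hasFDerivAt_e X)
  have h3 : HasFDerivAt (X.e.symm ∘ X.e) (ContinuousLinearMap.id ℝ _) (x₀, u₀) :=
    (hasFDerivAt_id _).congr_of_eventuallyEq (X.e.eventually_left_inverse X.mem_source)
  exact DFunLike.congr_fun (h2.unique h3) p

theorem hasFDerivAt_f (X : S.Extension x₀ u₀) :
    HasFDerivAt S.f ((ContinuousLinearMap.fst ℝ _ _).comp (fderiv ℝ X.e (x₀, u₀))) (x₀, u₀) :=
  (hasFDerivAt_e X).fst.congr_of_eventuallyEq
    (Filter.mem_of_superset (X.e.open_source.mem_nhds X.mem_source)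
      fun p hp => (X.fst_eq p hp).symm)

/-- This is where the independence of the inputs enters: ∂_u f has rank m, hence trivial kernel. -/
theorem fderiv_e_fst_injective (h_eq : S.IsEquilibrium x₀ u₀) (X : S.Extension x₀ u₀)
    {v : Fin m → ℝ} (hv : (fderiv ℝ X.e (x₀, u₀) (0, v)).1 = 0) : v = 0 := by
  have h1 : HasFDerivAt (fun u => S.f (x₀, u))
      (((ContinuousLinearMap.fst ℝ _ _).comp (fderiv ℝ X.e (x₀, u₀))).comp
        (ContinuousLinearMap.inr ℝ _ _)) u₀ :=
    HasFDerivAt.comp u₀ (hasFDerivAt_f X) (hasFDerivAt_prodMk_right x₀ u₀)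
  have h2 := S.rank_u _ h_eq.1
  rw [h1.fderiv] at h2
  have h3 := LinearMap.finrank_range_add_finrank_ker
    (((ContinuousLinearMap.fst ℝ _ _).comp (fderiv ℝ X.e (x₀, u₀))).comp
        (ContinuousLinearMap.inr ℝ (Fin n → ℝ) (Fin m → ℝ))).toLinearMap
  rw [h2, Module.finrank_fin_fun, Nat.add_eq_left, Submodule.finrank_eq_zero] at h3
  exact (LinearMap.ker_eq_bot'.1 h3) v hv

/-- The exponential trajectory is an eigenvector of the linearized forward-shift with eigenvalue z;
`hE` is exactly the condition for this. -/
theorem hasCoordDeriv_fwd (X : S.Extension x₀ u₀)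
    {c : ℝ → ExtSpace n m} (hc : c 0 = X.eqPoint) {a z : ℝ} (hz : z ≠ 0) {ξ : Fin n → ℝ}
    {v η : Fin m → ℝ} (hE : fderiv ℝ X.e (x₀, u₀) (ξ, v) = (z • ξ, η))
    (h : HasCoordDeriv c (a • expTraj z ξ v η)) :
    HasCoordDeriv (fun t => X.fwd (c t)) ((z * a) • expTraj z ξ v η) := by
  have h0 : HasDerivAt (fun t => ((c t).2.1, (c t).2.2 0)) (a • (ξ, v)) 0 := by
    have := h.2.1.prodMk (h.2.2 0)
    simpa [expTraj] using this
  have hpt : ((c 0).2.1, (c 0).2.2 0) = (x₀, u₀) := by rw [hc]; rfl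
  have he : HasDerivAt (fun t => X.e ((c t).2.1, (c t).2.2 0)) (a • (z • ξ, η)) 0 := by
    have := (hpt ▸ hasFDerivAt_e X : HasFDerivAt X.e (fderiv ℝ X.e (x₀, u₀))
      ((c 0).2.1, (c 0).2.2 0)).comp_hasDerivAt 0 h0
    rwa [map_smul, hE] at this
  have hf : HasDerivAt (fun t => S.f ((c t).2.1, (c t).2.2 0)) (a • z • ξ) 0 := by
    have := (hpt ▸ hasFDerivAt_f X : HasFDerivAt S.f
      ((ContinuousLinearMap.fst ℝ _ _).comp (fderiv ℝ X.e (x₀, u₀)))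
      ((c 0).2.1, (c 0).2.2 0)).comp_hasDerivAt 0 h0
    rw [map_smul, ContinuousLinearMap.comp_apply, hE] at this
    exact this
  refine ⟨fun k => ?_, hf.congr_deriv ?_, fun k => (h.2.2 (k + 1)).congr_deriv ?_⟩
  · cases k with
    | zero =>
      have h1 := HasFDerivAt.hasDerivAt he.snd
      refine HasDerivAt.congr_deriv h1 ?_
      change (1 : ℝ) • a • η = (z * a) • z⁻¹ ^ (0 + 1) • η
      rw [one_smul, smul_smul]; congr 1; rw [zero_add, pow_one]; field_simp
    | succ k =>
      refine (h.1 k).congr_deriv ?_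
      change a • z⁻¹ ^ (k + 1) • η = (z * a) • z⁻¹ ^ (k + 1 + 1) • η
      rw [smul_smul, smul_smul]; congr 1; rw [pow_succ _ (k + 1)]; field_simp
  · change a • z • ξ = (z * a) • ξ
    rw [smul_smul, mul_comm]
  · change a • z ^ (k + 1) • v = (z * a) • z ^ k • v
    rw [smul_smul, smul_smul]; congr 1; ring

theorem hasCoordDeriv_bwd (h_eq : S.IsEquilibrium x₀ u₀) (X : S.Extension x₀ u₀)
    {c : ℝ → ExtSpace n m} (hc : c 0 = X.eqPoint) {a z : ℝ} (hz : z ≠ 0) {ξ : Fin n → ℝ}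
    {v η : Fin m → ℝ} (hE : fderiv ℝ X.e (x₀, u₀) (ξ, v) = (z • ξ, η))
    (h : HasCoordDeriv c (a • expTraj z ξ v η)) :
    HasCoordDeriv (fun t => X.bwd (c t)) ((z⁻¹ * a) • expTraj z ξ v η) := by
  -- The pair (ξ, z⁻¹ η) read by the backward-shift is z⁻¹ E(ξ, v), which the derivative of the
  -- inverse sends to z⁻¹ (ξ, v).
  have h0 : HasDerivAt (fun t => ((c t).2.1, (c t).1 0)) ((z⁻¹ * a) • (z • ξ, η)) 0 := by
    refine (h.2.1.prodMk (h.1 0)).congr_deriv ?_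
    change (a • ξ, a • z⁻¹ ^ (0 + 1) • η) = ((z⁻¹ * a) • z • ξ, (z⁻¹ * a) • η)
    rw [smul_smul, smul_smul]
    congr 2
    · field_simp
    · rw [zero_add, pow_one, mul_comm]
  have hpt : ((c 0).2.1, (c 0).1 0) = (x₀, X.g (x₀, u₀)) := by rw [hc]; rfl
  have he : HasDerivAt (fun t => X.e.symm ((c t).2.1, (c t).1 0)) ((z⁻¹ * a) • (ξ, v)) 0 := by
    have := (hpt ▸ hasFDerivAt_symm h_eq X : HasFDerivAt X.e.symm
      (fderiv ℝ X.e.symm (x₀, X.g (x₀, u₀))) ((c 0).2.1, (c 0).1 0)).comp_hasDerivAt 0 h0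
    rwa [map_smul, ← hE, fderiv_symm_fderiv h_eq X] at this
  refine ⟨fun k => (h.1 (k + 1)).congr_deriv ?_, he.fst, fun k => ?_⟩
  · change a • z⁻¹ ^ (k + 1 + 1) • η = (z⁻¹ * a) • z⁻¹ ^ (k + 1) • η
    rw [smul_smul, smul_smul]; congr 1; ring
  · cases k with
    | zero =>
      have h1 := HasFDerivAt.hasDerivAt he.snd
      refine HasDerivAt.congr_deriv h1 ?_
      change (1 : ℝ) • (z⁻¹ * a) • v = (z⁻¹ * a) • z ^ 0 • v
      rw [pow_zero, one_smul, one_smul]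
    | succ k =>
      refine (h.2.2 k).congr_deriv ?_
      change a • z ^ k • v = (z⁻¹ * a) • z ^ (k + 1) • v
      rw [smul_smul, smul_smul]; congr 1; rw [pow_succ]; field_simp

theorem hasCoordDeriv_shift (h_eq : S.IsEquilibrium x₀ u₀) (X : S.Extension x₀ u₀)
    {c : ℝ → ExtSpace n m} (hc : c 0 = X.eqPoint) {z : ℝ} (hz : z ≠ 0) {ξ : Fin n → ℝ}
    {v η : Fin m → ℝ} (hE : fderiv ℝ X.e (x₀, u₀) (ξ, v) = (z • ξ, η))
    (h : HasCoordDeriv c (expTraj z ξ v η)) (k : ℤ) :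
    X.shift k (c 0) = X.eqPoint ∧
      HasCoordDeriv (fun t => X.shift k (c t)) (z ^ k • expTraj z ξ v η) := by
  have hf : ∀ k : ℕ, X.fwd^[k] (c 0) = X.eqPoint ∧
      HasCoordDeriv (fun t => X.fwd^[k] (c t)) (z ^ k • expTraj z ξ v η) := by
    intro k
    induction k with
    | zero => simpa using ⟨hc, h⟩
    | succ k ih =>
      simp only [Function.iterate_succ_apply', pow_succ']
      exact ⟨by rw [ih.1, fwd_eqPoint h_eq X], hasCoordDeriv_fwd X ih.1 hz hE ih.2⟩
  have hb : ∀ k : ℕ, X.bwd^[k] (c 0) = X.eqPoint ∧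
      HasCoordDeriv (fun t => X.bwd^[k] (c t)) (z⁻¹ ^ k • expTraj z ξ v η) := by
    intro k
    induction k with
    | zero => simpa using ⟨hc, h⟩
    | succ k ih =>
      simp only [Function.iterate_succ_apply', pow_succ']
      exact ⟨by rw [ih.1, bwd_eqPoint h_eq X], hasCoordDeriv_bwd h_eq X ih.1 hz hE ih.2⟩
  cases k with
  | ofNat k => simpa [shift] using hf k
  | negSucc k => simpa [zpow_negSucc, shift] using hb (k + 1)

end DTSystem.Extension

/-! ### Linearized flat parameterization on exponential trajectories -/

namespace FlatParameterization

variable {n m : ℕ} {S : DTSystem n m} {x₀ : Fin n → ℝ} {u₀ : Fin m → ℝ} {X : S.Extension x₀ u₀}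

/-- The derivative of the flat output at the equilibrium. -/
noncomputable def dφ (P : FlatParameterization X) :
    OutputVars n P.Q₁ P.Q₂ →L[ℝ] (Fin m → ℝ) :=
  fderiv ℝ P.φ (outputVars P.Q₁ P.Q₂ X.eqPoint)

/-- The derivative of `F_x`, applied to `y_[k] = z ^ k • y`. -/
noncomputable def dFx (P : FlatParameterization X) (z : ℝ) (y : Fin m → ℝ) : Fin n → ℝ :=
  fderiv ℝ P.Fx (restrictX P.yEq) fun w => z ^ (w.2 : ℤ) * y w.1

/-- The derivative of `F_u`, applied to `y_[k] = z ^ k • y`. -/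
noncomputable def dFu (P : FlatParameterization X) (z : ℝ) (y : Fin m → ℝ) : Fin m → ℝ :=
  fderiv ℝ P.Fu P.yEq fun w => z ^ (w.2 : ℤ) * y w.1

/-- Differentiate `x_eq` and `u_eq` along a line through the equilibrium. Each involves only
finitely many coordinates of finitely many shifts, so coordinatewise derivatives suffice. -/
theorem dFx_dFu_of_expTraj (h_eq : S.IsEquilibrium x₀ u₀) (P : FlatParameterization X) {z : ℝ}
    (hz : z ≠ 0) {ξ : Fin n → ℝ} {v η : Fin m → ℝ}
    (hE : fderiv ℝ X.e (x₀, u₀) (ξ, v) = (z • ξ, η)) :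
    ξ = P.dFx z (P.dφ (outputVars P.Q₁ P.Q₂ (expTraj z ξ v η))) ∧
      v = P.dFu z (P.dφ (outputVars P.Q₁ P.Q₂ (expTraj z ξ v η))) := by
  set d := expTraj z ξ v η with hd
  let c : ℝ → ExtSpace n m := fun t => X.eqPoint + t • d
  have hc : c 0 = X.eqPoint := by simp [c]
  have hcd : HasCoordDeriv c d := hasCoordDeriv_line _ _
  have hct : Tendsto c (𝓝 0) (𝓝 X.eqPoint) := tendsto_line _ _
  have hφ : HasFDerivAt P.φ P.dφ (outputVars P.Q₁ P.Q₂ X.eqPoint) :=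
    (P.smooth_φ.self_of_nhds.differentiableAt (by simp)).hasFDerivAt
  have hy : ∀ k : ℤ, HasDerivAt (fun t => P.φ (outputVars P.Q₁ P.Q₂ (X.shift k (c t))))
      (z ^ k • P.dφ (outputVars P.Q₁ P.Q₂ d)) 0 := by
    intro k
    obtain ⟨h1, h2⟩ := X.hasCoordDeriv_shift h_eq hc hz hE hcd k
    have h3 := (h1.symm ▸ hφ : HasFDerivAt P.φ P.dφ
      (outputVars P.Q₁ P.Q₂ (X.shift k (c 0)))).comp_hasDerivAt 0 (h2.outputVars P.Q₁ P.Q₂)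
    rwa [show outputVars P.Q₁ P.Q₂ (z ^ k • d) = z ^ k • outputVars P.Q₁ P.Q₂ d from rfl,
      map_smul] at h3
  have hs : ∀ k : ℤ, X.shift k (c 0) = X.eqPoint := fun k =>
    (X.hasCoordDeriv_shift h_eq hc hz hE hcd k).1
  constructor
  · have h1 : HasDerivAt (fun t => P.Fx fun w => P.φ (outputVars P.Q₁ P.Q₂ (X.shift w.2 (c t))) w.1)
        (P.dFx z (P.dφ (outputVars P.Q₁ P.Q₂ d))) 0 := by
      refine HasFDerivAt.comp_hasDerivAt (l := P.Fx) 0 ?_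
        (hasDerivAt_pi.2 fun w => hasDerivAt_pi.1 (hy w.2) w.1)
      simp only [hs]
      exact (P.smooth_Fx.self_of_nhds.differentiableAt (by simp)).hasFDerivAt
    exact (hcd.2.1.congr_of_eventuallyEq ((hct.eventually P.x_eq).mono fun t h => h.symm)).unique h1
  · have h1 : HasDerivAt (fun t => P.Fu fun w => P.φ (outputVars P.Q₁ P.Q₂ (X.shift w.2 (c t))) w.1)
        (P.dFu z (P.dφ (outputVars P.Q₁ P.Q₂ d))) 0 := by
      refine HasFDerivAt.comp_hasDerivAt (l := P.Fu) 0 ?_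
        (hasDerivAt_pi.2 fun w => hasDerivAt_pi.1 (hy w.2) w.1)
      simp only [hs]
      exact (P.smooth_Fu.self_of_nhds.differentiableAt (by simp)).hasFDerivAt
    have h2 := (hcd.2.2 0).congr_of_eventuallyEq
      ((hct.eventually P.u_eq).mono fun t h => h.symm)
    simpa [hd, expTraj] using h2.unique h1

/-- Dimension count: the amplitudes (ξ, v) form the kernel of `A`, and the output map `Y` is
injective on it because y determines ξ and v. -/
theorem exists_expTraj (h_eq : S.IsEquilibrium x₀ u₀) (P : FlatParameterization X) {z : ℝ}
    (hz : z ≠ 0) (y : Fin m → ℝ) :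
    ∃ ξ v η, fderiv ℝ X.e (x₀, u₀) (ξ, v) = (z • ξ, η) ∧
      P.dφ (outputVars P.Q₁ P.Q₂ (expTraj z ξ v η)) = y := by
  let E := fderiv ℝ X.e (x₀, u₀)
  let A : (Fin n → ℝ) × (Fin m → ℝ) →ₗ[ℝ] (Fin n → ℝ) :=
    LinearMap.fst ℝ _ _ ∘ₗ E.toLinearMap - z • LinearMap.fst ℝ _ _
  let Y : (Fin n → ℝ) × (Fin m → ℝ) →ₗ[ℝ] (Fin m → ℝ) :=
    { toFun := fun p => P.dφ (outputVars P.Q₁ P.Q₂ (expTraj z p.1 p.2 (E p).2))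
      map_add' := fun p q => by
        rw [← map_add]
        congr 1
        simp [outputVars, expTraj]
        constructor <;> rfl
      map_smul' := fun r p => by
        rw [RingHom.id_apply, ← map_smul]
        congr 1
        simp [outputVars, expTraj]
        constructor <;> (funext w; simp; ring) }
  have hA : ∀ p ∈ LinearMap.ker A, E (p.1, p.2) = (z • p.1, (E p).2) := fun p hp =>
    Prod.ext (sub_eq_zero.1 hp) rfl
  have hinj : Function.Injective (Y.domRestrict (LinearMap.ker A)) := by
    rw [← LinearMap.ker_eq_bot, LinearMap.ker_eq_bot']
    rintro ⟨p, hp⟩ hY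
    obtain ⟨h1, h2⟩ := P.dFx_dFu_of_expTraj h_eq hz (hA p hp)
    have hY' : P.dφ (outputVars P.Q₁ P.Q₂ (expTraj z p.1 p.2 (E p).2)) = 0 := hY
    rw [hY'] at h1 h2
    refine Subtype.ext (Prod.ext ?_ ?_)
    · simpa [dFx, ← Pi.zero_def] using h1
    · simpa [dFu, ← Pi.zero_def] using h2
  -- `A` maps a space of dimension n + m to one of dimension n.
  have hdim : Module.finrank ℝ (Fin m → ℝ) ≤ Module.finrank ℝ (LinearMap.ker A) := by
    have h1 := LinearMap.finrank_range_add_finrank_ker A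
    have h2 := Submodule.finrank_le (LinearMap.range A)
    simp only [Module.finrank_prod, Module.finrank_fin_fun] at h1 h2 ⊢
    omega
  have hsurj : Function.Surjective (Y.domRestrict (LinearMap.ker A)) :=
    (LinearMap.injective_iff_surjective_of_finrank_eq_finrank
      (le_antisymm (LinearMap.finrank_le_finrank_of_injective hinj) hdim)).1 hinj
  obtain ⟨⟨p, hp⟩, hpy⟩ := hsurj y
  exact ⟨p.1, p.2, (E p).2, hA p hp, hpy⟩

theorem linearized_identities (h_eq : S.IsEquilibrium x₀ u₀) (P : FlatParameterization X) {z : ℝ}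
    (hz : z ≠ 0) (y : Fin m → ℝ) :
    (fderiv ℝ X.e (x₀, u₀) (P.dFx z y, P.dFu z y)).1 = z • P.dFx z y ∧
      P.dφ (outputVars P.Q₁ P.Q₂ (expTraj z (P.dFx z y) (P.dFu z y)
        (fderiv ℝ X.e (x₀, u₀) (P.dFx z y, P.dFu z y)).2)) = y := by
  obtain ⟨ξ, v, η, hE, hy⟩ := P.exists_expTraj h_eq hz y
  obtain ⟨h1, h2⟩ := P.dFx_dFu_of_expTraj h_eq hz hE
  rw [hy] at h1 h2
  rw [← h1, ← h2, hE]
  exact ⟨rfl, hy⟩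

end FlatParameterization

/-! ### Openness of full rank -/

/-- Full column rank of a submatrix of the Jacobian is an open condition. -/
theorem eventually_rank_jacobian_eq {ι : Type*} [Fintype ι] [DecidableEq ι] {k m : ℕ}
    {F : (ι → ℝ) → (Fin k → ℝ)} {y : ι → ℝ} (hF : ContDiffAt ℝ ∞ F y) (idx : Fin m → ι)
    (h : ∀ c : Fin m → ℝ, fderiv ℝ F y (∑ j, c j • Pi.single (idx j) 1) = 0 → c = 0) :
    ∀ᶠ y' in 𝓝 y,
      (Matrix.of fun i j => fderiv ℝ F y' (Pi.single (idx j) 1) i : Matrix (Fin k) (Fin m) ℝ).rank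
        = m := by
  have hcont : ContinuousAt (fun y' => fun j => fderiv ℝ F y' (Pi.single (idx j) 1)) y :=
    continuousAt_pi.2 fun j =>
      ((hF.fderiv_right (m := 0) (by simp)).continuousAt).clm_apply continuousAt_const
  have hli : LinearIndependent ℝ fun j => fderiv ℝ F y (Pi.single (idx j) 1) := by
    rw [Fintype.linearIndependent_iff]
    intro c hc
    have := h c (by simpa using hc)
    simp [this]
  filter_upwards [hcont.eventually hli.eventually] with y' hy'
  rw [← Matrix.rank_transpose]
  exact (LinearIndependent.rank_matrix (M := (Matrix.of fun i j =>
    fderiv ℝ F y' (Pi.single (idx j) 1) i : Matrix (Fin k) (Fin m) ℝ).transpose) hy').trans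
    (Fintype.card_fin m)

/-! ### Limits z → 0 and z → ∞ -/

namespace FlatParameterization

variable {n m : ℕ} {S : DTSystem n m} {x₀ : Fin n → ℝ} {u₀ : Fin m → ℝ} {X : S.Extension x₀ u₀}

theorem dFx_zero_eq_zero (P : FlatParameterization X) (hR : P.R₂ = 0) (y : Fin m → ℝ) :
    P.dFx 0 y = 0 := by
  have : (fun w : WindowX P.R₁ P.R₂ => (0 : ℝ) ^ (w.2 : ℤ) * y w.1) = 0 := by
    funext w
    have h := (Finset.mem_Icc.1 w.2.2).2
    simp only [hR, Pi.zero_apply, Nat.cast_zero] at h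
    rw [zero_zpow _ (by omega), zero_mul, Pi.zero_apply]
  rw [dFx, this, map_zero]

/-- Since 0 ^ 0 = 1, `dFx 0` is the block ∂_y F_x. As z → 0 the state tends to 0; the state equation
then forces the input to 0, and the output identity gives y = 0. -/
theorem forward_injective (h_eq : S.IsEquilibrium x₀ u₀) (P : FlatParameterization X)
    (hQ : P.Q₁ = 0) (hR : P.R₁ = 0) {y : Fin m → ℝ} (hy : P.dFx 0 y = 0) : y = 0 := by
  have hpow : ∀ k : ℤ, 0 ≤ k → Tendsto (fun z : ℝ => z ^ k) (𝓝[≠] 0) (𝓝 (0 ^ k)) := fun k hk =>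
    (continuousAt_zpow₀ _ k (Or.inr hk)).tendsto.mono_left nhdsWithin_le_nhds
  have hx : Tendsto (fun z => P.dFx z y) (𝓝[≠] 0) (𝓝 0) := by
    rw [← hy]
    refine ((fderiv ℝ P.Fx _).continuous.tendsto _).comp (tendsto_pi_nhds.2 fun w => ?_)
    have h := (Finset.mem_Icc.1 w.2.2).1
    simp only [hR, Pi.zero_apply, Nat.cast_zero] at h
    exact (hpow _ (by omega)).mul_const _
  have hu : Tendsto (fun z => P.dFu z y) (𝓝[≠] 0) (𝓝 (P.dFu 0 y)) := by
    refine ((fderiv ℝ P.Fu _).continuous.tendsto _).comp (tendsto_pi_nhds.2 fun w => ?_)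
    have h := (Finset.mem_Icc.1 w.2.2).1
    simp only [hR, Pi.zero_apply, Nat.cast_zero] at h
    exact (hpow _ (by omega)).mul_const _
  have hz : Tendsto (fun z : ℝ => z) (𝓝[≠] 0) (𝓝 0) := nhdsWithin_le_nhds
  have hne : ∀ᶠ z : ℝ in 𝓝[≠] 0, z ≠ 0 := self_mem_nhdsWithin
  have hE := ((fderiv ℝ X.e (x₀, u₀)).continuous.tendsto _).comp (hx.prodMk_nhds hu)
  -- In the limit the state equation reads ∂_u f · `dFu 0 y` = 0.
  have hu0 : P.dFu 0 y = 0 := by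
    refine X.fderiv_e_fst_injective h_eq (tendsto_nhds_unique hE.fst_nhds ?_)
    refine (hz.smul hx).congr' ?_ |>.trans (by simp)
    filter_upwards [hne] with z h using (P.linearized_identities h_eq h y).1.symm
  rw [hu0] at hu
  have hφ : Tendsto (fun z => P.dφ (outputVars P.Q₁ P.Q₂ (expTraj z (P.dFx z y) (P.dFu z y)
        (fderiv ℝ X.e (x₀, u₀) (P.dFx z y, P.dFu z y)).2))) (𝓝[≠] 0) (𝓝 (P.dφ 0)) := by
    refine (P.dφ.continuous.tendsto _).comp (Tendsto.prodMk_nhds (tendsto_pi_nhds.2 fun w => ?_)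
      (hx.prodMk_nhds (tendsto_pi_nhds.2 fun w => ?_)))
    -- With `Q₁ = 0` there are no ζ-coordinates, whose negative powers of z could blow up.
    · have := w.2.2
      simp [hQ] at this
    · simpa [outputVars, expTraj] using (hz.pow w.2).mul (tendsto_pi_nhds.1 hu w.1)
  rw [map_zero] at hφ
  refine tendsto_nhds_unique (tendsto_const_nhds.congr' ?_) hφ
  filter_upwards [hne] with z h using (P.linearized_identities h_eq h y).2.symm

/-- The exponential rate is z⁻¹ with z → 0. The state involves only y_[k] with k ≤ -1 and so
vanishes in the limit without any assumption on y; the input tends to ∂_y F_u · y = 0, and therefore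
η tends to 0 as well. -/
theorem backward_injective (h_eq : S.IsEquilibrium x₀ u₀) (P : FlatParameterization X)
    (hQ : P.Q₂ = 0) (hR : P.R₂ = 0) {y : Fin m → ℝ} (hy : P.dFu 0 y = 0) : y = 0 := by
  -- For k < 0 the limit is 0, which agrees with the convention 0 ^ k = 0 for negative k.
  have hpow : ∀ k : ℤ, k ≤ 0 → Tendsto (fun z : ℝ => z⁻¹ ^ k) (𝓝[≠] 0) (𝓝 (0 ^ k)) := by
    intro k hk
    have h := (continuousAt_zpow₀ (0 : ℝ) (-k) (Or.inr (by omega))).tendsto.mono_left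
      (nhdsWithin_le_nhds (s := {0}ᶜ))
    simpa only [← inv_zpow', inv_zero] using h
  have hx : Tendsto (fun z => P.dFx z⁻¹ y) (𝓝[≠] 0) (𝓝 0) := by
    rw [← P.dFx_zero_eq_zero hR y]
    refine ((fderiv ℝ P.Fx _).continuous.tendsto _).comp (tendsto_pi_nhds.2 fun w => ?_)
    have h := (Finset.mem_Icc.1 w.2.2).2
    simp only [hR, Pi.zero_apply, Nat.cast_zero] at h
    exact (hpow _ (by omega)).mul_const _
  have hu : Tendsto (fun z => P.dFu z⁻¹ y) (𝓝[≠] 0) (𝓝 0) := by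
    rw [← hy]
    refine ((fderiv ℝ P.Fu _).continuous.tendsto _).comp (tendsto_pi_nhds.2 fun w => ?_)
    have h := (Finset.mem_Icc.1 w.2.2).2
    simp only [hR, Pi.zero_apply, Nat.cast_zero] at h
    exact (hpow _ (by omega)).mul_const _
  have hz : Tendsto (fun z : ℝ => z) (𝓝[≠] 0) (𝓝 0) := nhdsWithin_le_nhds
  have hne : ∀ᶠ z : ℝ in 𝓝[≠] 0, z ≠ 0 := self_mem_nhdsWithin
  have hE := (((fderiv ℝ X.e (x₀, u₀)).continuous.tendsto _).comp (hx.prodMk_nhds hu)).snd_nhds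
  have hφ : Tendsto (fun z => P.dφ (outputVars P.Q₁ P.Q₂ (expTraj z⁻¹ (P.dFx z⁻¹ y) (P.dFu z⁻¹ y)
        (fderiv ℝ X.e (x₀, u₀) (P.dFx z⁻¹ y, P.dFu z⁻¹ y)).2))) (𝓝[≠] 0) (𝓝 (P.dφ 0)) := by
    refine (P.dφ.continuous.tendsto _).comp (Tendsto.prodMk_nhds (tendsto_pi_nhds.2 fun w => ?_)
      (hx.prodMk_nhds (tendsto_pi_nhds.2 fun w => ?_)))
    · simpa [outputVars, expTraj] using (hz.pow (w.2 + 1)).mul (tendsto_pi_nhds.1 hE w.1)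
    · have h0 : (w.2 : ℕ) = 0 := by
        have := w.2.2
        simp only [hQ, Pi.zero_apply] at this
        omega
      simpa [outputVars, expTraj, h0] using tendsto_pi_nhds.1 hu w.1
  rw [map_zero] at hφ
  refine tendsto_nhds_unique (tendsto_const_nhds.congr' ?_) hφ
  filter_upwards [hne] with z h using (P.linearized_identities h_eq (inv_ne_zero h) y).2.symm

/-- Identifies a combination of Jacobian columns with the value at z = 0 of the direction z^k c, as
used in `dFx` and `dFu`. -/
theorem sum_single_bottomIdx {R₁ R₂ : Fin m → ℕ} (hR : R₁ = 0) (c : Fin m → ℝ) :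
    ∑ j, c j • Pi.single (M := fun _ : WindowU R₁ R₂ => ℝ) (bottomIdx R₁ R₂ j) (1 : ℝ) =
      fun w => (0 : ℝ) ^ (w.2 : ℤ) * c w.1 := by
  funext ⟨i, k, hk⟩
  have h := (Finset.mem_Icc.1 hk).1
  simp only [hR, Pi.zero_apply, Nat.cast_zero] at h
  rw [Finset.sum_apply, Finset.sum_eq_single i]
  · by_cases h0 : k = 0
    · subst h0
      have : (⟨i, 0, hk⟩ : WindowU R₁ R₂) = bottomIdx R₁ R₂ i := by simp [bottomIdx, hR]
      rw [this, Pi.smul_apply, Pi.single_eq_same]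
      simp [bottomIdx, hR]
    · have : (⟨i, k, hk⟩ : WindowU R₁ R₂) ≠ bottomIdx R₁ R₂ i := by simpa [bottomIdx, hR] using h0
      simp [Pi.single_eq_of_ne this, zero_zpow k h0]
  · intro j _ hj
    have : (⟨i, k, hk⟩ : WindowU R₁ R₂) ≠ bottomIdx R₁ R₂ j := fun h' =>
      hj (congrArg Sigma.fst h').symm
    simp [Pi.single_eq_of_ne this]
  · simp

theorem sum_single_topIdx {R₁ R₂ : Fin m → ℕ} (hR : R₂ = 0) (c : Fin m → ℝ) :
    ∑ j, c j • Pi.single (M := fun _ : WindowU R₁ R₂ => ℝ) (topIdx R₁ R₂ j) (1 : ℝ) =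
      fun w => (0 : ℝ) ^ (w.2 : ℤ) * c w.1 := by
  funext ⟨i, k, hk⟩
  rw [Finset.sum_apply, Finset.sum_eq_single i]
  · by_cases h0 : k = 0
    · subst h0
      have : (⟨i, 0, hk⟩ : WindowU R₁ R₂) = topIdx R₁ R₂ i := by simp [topIdx, hR]
      rw [this, Pi.smul_apply, Pi.single_eq_same]
      simp [topIdx, hR]
    · have : (⟨i, k, hk⟩ : WindowU R₁ R₂) ≠ topIdx R₁ R₂ i := by simpa [topIdx, hR] using h0
      simp [Pi.single_eq_of_ne this, zero_zpow k h0]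
  · intro j _ hj
    have : (⟨i, k, hk⟩ : WindowU R₁ R₂) ≠ topIdx R₁ R₂ j := fun h' =>
      hj (congrArg Sigma.fst h').symm
    simp [Pi.single_eq_of_ne this]
  · simp

/-- The restriction to `y_[-R₁,R₂-1]` as a continuous linear map. -/
def restrictXL (R₁ R₂ : Fin m → ℕ) : (WindowU R₁ R₂ → ℝ) →L[ℝ] (WindowX R₁ R₂ → ℝ) where
  toFun := restrictX
  map_add' _ _ := rfl
  map_smul' _ _ := rfl
  cont := continuous_pi fun _ => continuous_apply _

end FlatParameterization

theorem mainTheorem2 {n m : ℕ} (S : DTSystem n m) (x₀ : Fin n → ℝ) (u₀ : Fin m → ℝ)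
    (h_eq : S.IsEquilibrium x₀ u₀) (X : S.Extension x₀ u₀) (P : FlatParameterization X) :
    (P.IsForwardFlat → ∀ᶠ y in 𝓝 P.yEq, (P.jacFx y).rank = m) ∧
    (P.IsBackwardFlat → ∀ᶠ y in 𝓝 P.yEq, (P.jacFu y).rank = m) := by
  constructor
  · rintro ⟨hQ, hR⟩
    have hFx : ContDiffAt ℝ ∞ P.Fx (restrictX P.yEq) := P.smooth_Fx.self_of_nhds
    refine eventually_rank_jacobian_eq
      (hFx.comp P.yEq (FlatParameterization.restrictXL P.R₁ P.R₂).contDiff.contDiffAt)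
      (bottomIdx P.R₁ P.R₂) fun c hc => ?_
    have h1 := (hFx.differentiableAt (by simp)).hasFDerivAt.comp P.yEq
      (FlatParameterization.restrictXL P.R₁ P.R₂).hasFDerivAt
    rw [FlatParameterization.sum_single_bottomIdx hR] at hc
    -- Restricting the direction 0^k c to the window of F_x gives, by definition, the argument of
    -- the derivative in `dFx 0 c`.
    exact P.forward_injective h_eq hQ hR ((DFunLike.congr_fun h1.fderiv _).symm.trans hc)
  · rintro ⟨hQ, hR⟩
    refine eventually_rank_jacobian_eq P.smooth_Fu.self_of_nhds (topIdx P.R₁ P.R₂) fun c hc => ?_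
    rw [FlatParameterization.sum_single_topIdx hR] at hc
    exact P.backward_injective h_eq hQ hR hc
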